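/- Let $(X,\mathcal F,\mu)$ be a probability space and let $T:X\to X$ be an invertible, bi-measurable, measure-preserving and ergodic transformation. Let $\mathcal Z_1$ be the Kronecker factor of $T$, that is, the closed linear span in $L^2(\mu;\mathbb C)$ of the eigenfunctions of $T$ (the $g\in L^2(\mu;\mathbb C)$, $g\neq 0$, with $g\circ T=c\,g$ for some $c\in\mathbb C$), and let $f\in L^2(\mu;\mathbb C)$ belong to $\mathcal Z_1^\perp$, i.e. let $f$ be orthogonal to every eigenfunction of $T$. Then there is a measurable set $X_f\subset X$ with $\mu(X_f)=1$ such that for every $x\in X_f$ and every nonzero integer $a$, \[ \limsup_{N\to\infty}\ \sup_{t\in\mathbb R}\left|\frac1N\sum_{n=1}^N f(T^{an}x)\,e^{2\pi i n t}\right| = 0 . \] -/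

import Mathlib

open MeasureTheory

noncomputable section

/-- The Koopman operator `g ↦ g ∘ T` on `L²(μ; ℂ)`. -/
def koopman {X : Type*} [MeasurableSpace X] {μ : Measure X} (T : X → X)
    (hT : MeasurePreserving T μ μ) : Lp ℂ 2 μ →ₗ[ℂ] Lp ℂ 2 μ :=
  (Lp.compMeasurePreservingₗᵢ ℂ T hT).toLinearMap

/-- The Kronecker factor of `T`, as a closed subspace of `L²(μ; ℂ)`: the closed linear span of all
`L²` eigenfunctions `g ∘ T = c • g` of `T`. -/
def kroneckerFactor {X : Type*} [MeasurableSpace X] {μ : Measure X} (T : X → X)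
    (hT : MeasurePreserving T μ μ) : Submodule ℂ (Lp ℂ 2 μ) :=
  (⨆ c : ℂ, Module.End.eigenspace (koopman T hT) c).topologicalClosure

/-- The Wiener–Wintner average `(1/N) ∑_{n=1}^N f(T^{an} x) e^{2πint}`; the power `T^{an}` with
integer exponent is taken in the group of bijections of `X`. -/
def wienerWintnerAvg {X : Type*} [MeasurableSpace X] (T : X ≃ᵐ X) (f : X → ℂ) (a : ℤ) (x : X)
    (N : ℕ) (t : ℝ) : ℂ :=
  (1 / (N : ℂ)) * ∑ n ∈ Finset.Icc 1 N,
    f (((T.toEquiv : Equiv.Perm X) ^ (a * (n : ℤ))) x) *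
      Complex.exp (2 * Real.pi * Complex.I * n * t)

end

/-! For almost every `x`, the pointwise ergodic theorem identifies the autocorrelations of `n ↦ f
(T^n x)` with the correlations `∫ f ∘ T^k * conj f`. These are Fourier coefficients of the spectral
measure of `f`. As `f` is orthogonal to all eigenfunctions, Wiener's lemma
(`tendsto_average_norm_inner_pow_sq`) makes them tend to zero in the Cesàro sense.

The van der Corput inequality bounds the exponential sums by the moduli of autocorrelations. The
factors `e^{2πint}` do not change these moduli, whence the uniformity in `t`
(`eventually_norm_sum_mul_exp_le`).

Since `T^a` need not be ergodic, general `a` is reduced to `a = ±1`: roots of unity pick out the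
multiples of `|a|`, at the cost of shifting `t`, which uniformity absorbs. -/

/-! ### Pointwise ergodic theorem. -/

/-- `maxBirkhoffSum T g n x` is the maximum of the Birkhoff sums of `g` of lengths `1, …, n + 1`. -/
def maxBirkhoffSum {X : Type*} (T : X → X) (g : X → ℝ) : ℕ → X → ℝ
  | 0 => g
  | n + 1 => fun x => g x + max 0 (maxBirkhoffSum T g n (T x))

lemma maxBirkhoffSum_succ {X : Type*} (T : X → X) (g : X → ℝ) (n : ℕ) (x : X) :
    maxBirkhoffSum T g (n + 1) x = g x + max 0 (maxBirkhoffSum T g n (T x)) := rfl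

lemma maxBirkhoffSum_le_succ {X : Type*} (T : X → X) (g : X → ℝ) (n : ℕ) (x : X) :
    maxBirkhoffSum T g n x ≤ maxBirkhoffSum T g (n + 1) x := by
  induction n generalizing x with
  | zero => simp [maxBirkhoffSum]
  | succ n ih =>
    rw [maxBirkhoffSum_succ, maxBirkhoffSum_succ T g (n + 1)]
    gcongr
    exact ih _

lemma le_maxBirkhoffSum {X : Type*} (T : X → X) (g : X → ℝ) (n : ℕ) (x : X) :
    g x ≤ maxBirkhoffSum T g n x := by
  cases n with
  | zero => exact le_rfl
  | succ n => simp [maxBirkhoffSum_succ]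

lemma birkhoffSum_le_maxBirkhoffSum {X : Type*} (T : X → X) (g : X → ℝ) (n : ℕ) (x : X) :
    birkhoffSum T g (n + 1) x ≤ maxBirkhoffSum T g n x := by
  induction n generalizing x with
  | zero => simp [maxBirkhoffSum]
  | succ n ih =>
    rw [birkhoffSum_succ', maxBirkhoffSum_succ]
    gcongr
    exact (ih _).trans (le_max_right _ _)

/-- The recursion changes bounds only by finite amounts depending on `g x`. The set of points with
bounded maxima is therefore `T`-invariant, so ergodicity applies to it. -/
lemma bddAbove_maxBirkhoffSum_comp {X : Type*} {T : X → X} {g : X → ℝ} (x : X) :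
    BddAbove (Set.range fun n => maxBirkhoffSum T g n (T x)) ↔
      BddAbove (Set.range fun n => maxBirkhoffSum T g n x) := by
  constructor
  · rintro ⟨C, hC⟩
    refine ⟨g x + max 0 C, ?_⟩
    rintro _ ⟨n, rfl⟩
    refine (maxBirkhoffSum_le_succ T g n x).trans ?_
    rw [maxBirkhoffSum_succ]
    gcongr
    exact hC ⟨n, rfl⟩
  · rintro ⟨C, hC⟩
    refine ⟨C - g x, ?_⟩
    rintro _ ⟨n, rfl⟩
    have := hC ⟨n + 1, rfl⟩
    simp only [maxBirkhoffSum_succ] at this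
    have := le_max_right 0 (maxBirkhoffSum T g n (T x))
    simp only
    linarith

section Birkhoff

variable {X : Type*} [MeasurableSpace X] {μ : Measure X} {T : X → X} {g : X → ℝ}

lemma integrable_maxBirkhoffSum (hT : MeasurePreserving T μ μ) (hg : Integrable g μ) (n : ℕ) :
    Integrable (maxBirkhoffSum T g n) μ := by
  induction n with
  | zero => exact hg
  | succ n ih =>
    refine hg.add ?_
    have := (hT.integrable_comp_of_integrable ih).pos_part
    simpa [max_comm] using this

open Filter Topology in
/-- If `∫ g < 0` and `T` is ergodic, the Birkhoff sums of `g` are almost surely bounded above. -/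
theorem ae_bddAbove_maxBirkhoffSum (hT : Ergodic T μ) (hg : Integrable g μ)
    (hneg : ∫ x, g x ∂μ < 0) :
    ∀ᵐ x ∂μ, BddAbove (Set.range fun n => maxBirkhoffSum T g n x) := by
  have hmp := hT.toMeasurePreserving
  have hInt := integrable_maxBirkhoffSum hmp hg
  set A : Set X := {x | BddAbove (Set.range fun n => maxBirkhoffSum T g n x)} with hA
  have hAeq : A = ⋃ c : ℕ, ⋂ n : ℕ, {x | maxBirkhoffSum T g n x ≤ c} := by
    ext x
    simp only [hA, Set.mem_ofPred_eq, Set.mem_iUnion, Set.mem_iInter]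
    constructor
    · rintro ⟨C, hC⟩
      obtain ⟨c, hc⟩ := exists_nat_ge C
      exact ⟨c, fun n => (hC ⟨n, rfl⟩).trans hc⟩
    · rintro ⟨c, hc⟩
      exact ⟨c, by rintro _ ⟨n, rfl⟩; exact hc n⟩
  have hAm : NullMeasurableSet A μ := by
    rw [hAeq]
    exact .iUnion fun c => .iInter fun n =>
      nullMeasurableSet_le (hInt n).aemeasurable aemeasurable_const
  have hinv : T ⁻¹' A = A := by
    ext x
    exact bddAbove_maxBirkhoffSum_comp x
  rcases hT.quasiErgodic.ae_mem_or_ae_notMem₀ hAm (by rw [hinv]; exact ae_eq_refl _) with h | h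
  · exact h
  exfalso
  -- Suppose the maxima `M n` are almost surely unbounded. Then `M (n + 1) - M n ∘ T` has
  -- nonnegative integral, by monotonicity and invariance, yet equals `g` plus the negative part of
  -- `M n ∘ T`, which vanishes in the limit. This forces `0 ≤ ∫ g`.
  have hd (n : ℕ) (x : X) : maxBirkhoffSum T g (n + 1) x - maxBirkhoffSum T g n (T x) =
      g x + max 0 (-maxBirkhoffSum T g n (T x)) := by
    rw [maxBirkhoffSum_succ]
    rcases le_total 0 (maxBirkhoffSum T g n (T x)) with h | h
    · rw [max_eq_right h, max_eq_left (by linarith)]; ring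
    · rw [max_eq_left h, max_eq_right (by linarith)]; ring
  have hnonneg (n : ℕ) : 0 ≤ ∫ x, (g x + max 0 (-maxBirkhoffSum T g n (T x))) ∂μ := by
    simp_rw [← hd]
    rw [integral_sub (g := fun x => maxBirkhoffSum T g n (T x)) (hInt _)
      (hmp.integrable_comp_of_integrable (hInt n))]
    have h1 : ∫ x, maxBirkhoffSum T g n (T x) ∂μ = ∫ x, maxBirkhoffSum T g n x ∂μ := by
      have := integral_map (μ := μ) (φ := T) hmp.aemeasurable (f := maxBirkhoffSum T g n)
        (by rw [hmp.map_eq]; exact (hInt n).aestronglyMeasurable)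
      rw [hmp.map_eq] at this
      exact this.symm
    rw [h1, sub_nonneg]
    exact integral_mono (hInt n) (hInt _) (maxBirkhoffSum_le_succ T g n)
  have hlim : Tendsto (fun n => ∫ x, (g x + max 0 (-maxBirkhoffSum T g n (T x))) ∂μ) atTop
      (𝓝 (∫ x, g x ∂μ)) := by
    refine tendsto_integral_of_dominated_convergence (fun x => |g x| + |g (T x)|) ?_ ?_ ?_ ?_
    · intro n
      simp_rw [← hd]
      exact ((hInt _).sub (hmp.integrable_comp_of_integrable (hInt n))).aestronglyMeasurable
    · exact hg.abs.add (hmp.integrable_comp_of_integrable hg).abs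
    · intro n
      refine Eventually.of_forall fun x => ?_
      rw [Real.norm_eq_abs]
      refine (abs_add_le _ _).trans ?_
      refine add_le_add_right ?_ _
      rw [abs_of_nonneg (le_max_left _ _)]
      refine max_le (abs_nonneg _) ?_
      have := le_maxBirkhoffSum T g n (T x)
      have := neg_abs_le (g (T x))
      linarith
    · filter_upwards [h] with x hx
      have hx' : ¬ BddAbove (Set.range fun n => maxBirkhoffSum T g n (T x)) := by
        rwa [bddAbove_maxBirkhoffSum_comp]
      have hmono : Monotone fun n => maxBirkhoffSum T g n (T x) :=
        monotone_nat_of_le_succ fun n => maxBirkhoffSum_le_succ T g n (T x)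
      have ht := tendsto_atTop_atTop_of_monotone' hmono hx'
      refine tendsto_const_nhds.congr' ?_
      filter_upwards [ht.eventually_ge_atTop 0] with n hn
      rw [max_eq_left (by linarith), add_zero]
  exact absurd (ge_of_tendsto' hlim hnonneg) (not_le.2 hneg)

open Filter Topology in
-- Subtracting `I + ε / 2` makes the integral negative, so the new Birkhoff sums are bounded by some
-- `C`; the other `ε / 2` absorbs `C` for large `n`.
lemma ae_eventually_birkhoffSum_le [IsProbabilityMeasure μ] (hT : Ergodic T μ)
    (hg : Integrable g μ) {ε : ℝ} (hε : 0 < ε) :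
    ∀ᵐ x ∂μ, ∀ᶠ n : ℕ in atTop, birkhoffSum T g n x ≤ n * (∫ y, g y ∂μ + ε) := by
  set I := ∫ y, g y ∂μ
  have hg' : Integrable (fun x => g x - (I + ε / 2)) μ := hg.sub (integrable_const _)
  have hneg : ∫ x, (g x - (I + ε / 2)) ∂μ < 0 := by
    rw [integral_sub hg (integrable_const _)]
    simp only [integral_const, probReal_univ, one_smul]
    change I - _ < 0
    linarith
  filter_upwards [ae_bddAbove_maxBirkhoffSum hT hg' hneg] with x hx
  obtain ⟨C, hC⟩ := hx
  have hlarge : ∀ᶠ n : ℕ in atTop, C ≤ n * (ε / 2) :=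
    (tendsto_natCast_atTop_atTop.atTop_mul_const (half_pos hε)).eventually_ge_atTop C
  filter_upwards [hlarge, eventually_gt_atTop 0] with n hn hpos
  obtain ⟨m, rfl⟩ := Nat.exists_eq_succ_of_ne_zero hpos.ne'
  have h1 := (birkhoffSum_le_maxBirkhoffSum T _ m x).trans (hC ⟨m, rfl⟩)
  have h2 : birkhoffSum T (fun x => g x - (I + ε / 2)) (m + 1) x =
      birkhoffSum T g (m + 1) x - (m + 1 : ℕ) * (I + ε / 2) := by
    simp [birkhoffSum, Finset.sum_sub_distrib, mul_add]
  rw [h2] at h1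
  simp only [Nat.succ_eq_add_one] at *
  linarith

open Filter Topology in
/-- Pointwise ergodic theorem for ergodic maps and real integrable functions. -/
theorem ae_tendsto_birkhoffSum_div [IsProbabilityMeasure μ] (hT : Ergodic T μ)
    (hg : Integrable g μ) :
    ∀ᵐ x ∂μ, Tendsto (fun n : ℕ => birkhoffSum T g n x / n) atTop (𝓝 (∫ y, g y ∂μ)) := by
  have h1 : ∀ᵐ x ∂μ, ∀ k : ℕ, ∀ᶠ n : ℕ in atTop,
      birkhoffSum T g n x ≤ n * (∫ y, g y ∂μ + 1 / ((k : ℝ) + 1)) :=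
    ae_all_iff.2 fun k => ae_eventually_birkhoffSum_le hT hg Nat.one_div_pos_of_nat
  have h2 : ∀ᵐ x ∂μ, ∀ k : ℕ, ∀ᶠ n : ℕ in atTop,
      birkhoffSum T (-g) n x ≤ n * (∫ y, (-g) y ∂μ + 1 / ((k : ℝ) + 1)) :=
    ae_all_iff.2 fun k => ae_eventually_birkhoffSum_le hT hg.neg Nat.one_div_pos_of_nat
  filter_upwards [h1, h2] with x hx1 hx2
  rw [Metric.tendsto_nhds]
  intro ε hε
  obtain ⟨k, hk⟩ := exists_nat_one_div_lt hε
  filter_upwards [hx1 k, hx2 k, eventually_gt_atTop 0] with n hn1 hn2 hpos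
  have hn : (0 : ℝ) < n := by exact_mod_cast hpos
  have hs : birkhoffSum T (-g) n x = -birkhoffSum T g n x := by simp [birkhoffSum]
  rw [hs] at hn2
  simp only [Pi.neg_apply, integral_neg] at hn2
  have e1 : birkhoffSum T g n x / n ≤ ∫ y, g y ∂μ + 1 / ((k : ℝ) + 1) := by
    rw [div_le_iff₀ hn]; linarith
  have e2 : ∫ y, g y ∂μ - 1 / ((k : ℝ) + 1) ≤ birkhoffSum T g n x / n := by
    rw [le_div_iff₀ hn]; linarith
  rw [Real.dist_eq, abs_lt]
  constructor <;> linarith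

open Filter Topology in
/-- Pointwise ergodic theorem for ergodic maps and complex integrable functions. -/
theorem ae_tendsto_birkhoffSum_div_complex [IsProbabilityMeasure μ] (hT : Ergodic T μ)
    {g : X → ℂ} (hg : Integrable g μ) :
    ∀ᵐ x ∂μ, Tendsto (fun n : ℕ => birkhoffSum T g n x / n) atTop (𝓝 (∫ y, g y ∂μ)) := by
  filter_upwards [ae_tendsto_birkhoffSum_div hT hg.re, ae_tendsto_birkhoffSum_div hT hg.im]
    with x h1 h2
  have h1' := (Complex.continuous_ofReal.tendsto _).comp h1
  have h2' := ((Complex.continuous_ofReal.tendsto _).comp h2).mul_const Complex.I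
  have h := h1'.add h2'
  have hI := integral_re_add_im hg
  simp only [RCLike.re_to_complex, RCLike.im_to_complex, RCLike.I_to_complex,
    Complex.coe_algebraMap] at h hI
  rw [show ((∫ y, g y ∂μ : ℂ)) = _ from hI.symm]
  refine h.congr fun n => ?_
  simp only [Function.comp, birkhoffSum]
  push_cast
  rw [← Complex.re_add_im ((∑ k ∈ Finset.range n, g (T^[k] x)) / n)]
  simp [Complex.div_natCast_re, Complex.div_natCast_im]

end Birkhoff

/-! ### Van der Corput inequality and uniformity in the frequency. -/

/-- The interval `[-H, N)` contains every translate of `[0, M)` by `-h`, so no boundary terms are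
lost. -/
lemma sum_Ico_int_shift {G : ℤ → ℂ} {M N H h : ℕ} (hMN : M ≤ N) (hh : h ≤ H)
    (hG : ∀ n : ℤ, (n < 0 ∨ (M : ℤ) ≤ n) → G n = 0) :
    ∑ m ∈ Finset.Ico (-H : ℤ) N, G (m + h) = ∑ n ∈ Finset.range M, G n := by
  symm
  refine Finset.sum_bij_ne_zero (fun n _ _ => (n : ℤ) - h) ?_ ?_ ?_ ?_
  · intro n hn _
    rw [Finset.mem_range] at hn
    rw [Finset.mem_Ico]
    omega
  · intro a _ _ b _ _ hab
    omega
  · intro m _ hm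
    have hlt : ¬ (m + h < 0 ∨ (M : ℤ) ≤ m + h) := fun h' => hm (hG _ h')
    push Not at hlt
    refine ⟨(m + h).toNat, ?_, ?_, ?_⟩
    · rw [Finset.mem_range]; omega
    · rwa [Int.toNat_of_nonneg hlt.1]
    · omega
  · intro n _ _
    simp

/-- The truncated autocorrelation `∑_{n + k < N} u (n + k) conj (u n)`. -/
def autocorrelation (u : ℕ → ℂ) (N k : ℕ) : ℂ :=
  ∑ n ∈ Finset.range (N - k), u (n + k) * (starRingEnd ℂ) (u n)

/-- Each distance `k` occurs at most twice, once on either side of `h`. -/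
lemma sum_natDist_le {a : ℕ → ℝ} (ha : ∀ k, 0 ≤ a k) {H h : ℕ} (hh : h < H) :
    ∑ h' ∈ Finset.range H, a (Nat.dist h h') ≤ 2 * ∑ k ∈ Finset.range H, a k := by
  rw [← Finset.sum_filter_add_sum_filter_not (Finset.range H) (fun h' => h' ≤ h), two_mul]
  refine add_le_add ?_ ?_
  · rw [← Finset.sum_image (f := a) (g := fun h' => Nat.dist h h')]
    · refine Finset.sum_le_sum_of_subset_of_nonneg ?_ fun i _ _ => ha i
      intro k hk
      simp only [Finset.mem_image, Finset.mem_filter, Finset.mem_range, Nat.dist] at hk ⊢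
      omega
    · intro x hx y hy hxy
      simp only [Finset.coe_filter, Finset.mem_range, Set.mem_ofPred_eq, Nat.dist] at hx hy hxy
      omega
  · rw [← Finset.sum_image (f := a) (g := fun h' => Nat.dist h h')]
    · refine Finset.sum_le_sum_of_subset_of_nonneg ?_ fun i _ _ => ha i
      intro k hk
      simp only [Finset.mem_image, Finset.mem_filter, Finset.mem_range, Nat.dist] at hk ⊢
      omega
    · intro x hx y hy hxy
      simp only [Finset.coe_filter, Finset.mem_range, Set.mem_ofPred_eq, Nat.dist] at hx hy hxy
      omega

/-- The van der Corput inequality. -/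
theorem vanDerCorput_inequality (u : ℕ → ℂ) (N : ℕ) {H : ℕ} (hH : 0 < H) :
    H * ‖∑ n ∈ Finset.range N, u n‖ ^ 2 ≤
      2 * (N + H) * ∑ k ∈ Finset.range H, ‖autocorrelation u N k‖ := by
  set v : ℤ → ℂ := fun m => if 0 ≤ m ∧ m < N then u m.toNat else 0 with hv
  have hv0 : ∀ n : ℤ, (n < 0 ∨ (N : ℤ) ≤ n) → v n = 0 := by
    intro n hn
    rw [hv]
    exact if_neg (by omega)
  have hvn : ∀ n < N, v n = u n := by
    intro n hn
    simp [hv, hn]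
  set I := Finset.Ico (-H : ℤ) N with hI
  -- Window sums of length `H` of the extension of `u` by zero: each `u n` lies in exactly `H`
  -- windows, and at most `N + H` windows are nonzero. Cauchy–Schwarz over the windows gives the
  -- inequality.
  set F : ℤ → ℂ := fun m => ∑ h ∈ Finset.range H, v (m + h) with hF
  have hsum : ∑ m ∈ I, F m = H * ∑ n ∈ Finset.range N, u n := by
    rw [hF, Finset.sum_comm]
    have : ∀ h ∈ Finset.range H, ∑ m ∈ I, v (m + h) = ∑ n ∈ Finset.range N, u n := by
      intro h hh
      rw [hI, sum_Ico_int_shift le_rfl (Finset.mem_range.1 hh).le hv0]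
      exact Finset.sum_congr rfl fun n hn => hvn n (Finset.mem_range.1 hn)
    rw [Finset.sum_congr rfl this]
    simp
  have hcard : (I.card : ℝ) = N + H := by
    rw [hI, Int.card_Ico]
    have : ((N : ℤ) - -(H : ℤ)).toNat = N + H := by omega
    rw [this]; push_cast; ring
  have hcorr_le : ∀ h < H, ∀ h' ≤ h,
      ∑ m ∈ I, v (m + h) * (starRingEnd ℂ) (v (m + h')) = autocorrelation u N (h - h') := by
    intro h hh h' hle
    have h1 := sum_Ico_int_shift (G := fun n => v (n + (h - h' : ℕ)) * (starRingEnd ℂ) (v n))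
      (M := N - (h - h')) (N := N) (H := H) (h := h') (Nat.sub_le _ _) (by omega) (by
        intro n hn
        by_cases hn0 : n < 0
        · simp [hv0 n (Or.inl hn0)]
        · rw [hv0 (n + (h - h' : ℕ)) (by right; omega), zero_mul])
    have h2 : ∑ m ∈ I, v (m + h) * (starRingEnd ℂ) (v (m + h')) =
        ∑ m ∈ I, v (m + h' + (h - h' : ℕ)) * (starRingEnd ℂ) (v (m + h')) := by
      refine Finset.sum_congr rfl fun m _ => ?_
      congr 2
      omega
    rw [h2, hI, h1, autocorrelation]
    refine Finset.sum_congr rfl fun n hn => ?_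
    rw [Finset.mem_range] at hn
    rw [← hvn (n + (h - h')) (by omega), ← hvn n (by omega)]
    push_cast
    rfl
  have hcorr : ∀ h < H, ∀ h' < H,
      ‖∑ m ∈ I, v (m + h) * (starRingEnd ℂ) (v (m + h'))‖ =
        ‖autocorrelation u N (Nat.dist h h')‖ := by
    intro h hh h' hh'
    rcases le_total h' h with hle | hle
    · rw [hcorr_le h hh h' hle, Nat.dist_eq_sub_of_le_right hle]
    · rw [Nat.dist_eq_sub_of_le hle, ← hcorr_le h' hh' h hle, ← RCLike.norm_conj, map_sum]
      congr 1
      refine Finset.sum_congr rfl fun m _ => ?_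
      simp [mul_comm]
  have hsq : ∑ m ∈ I, ‖F m‖ ^ 2 ≤
      ∑ h ∈ Finset.range H, ∑ h' ∈ Finset.range H, ‖autocorrelation u N (Nat.dist h h')‖ := by
    have e : ((∑ m ∈ I, ‖F m‖ ^ 2 : ℝ) : ℂ) = ∑ h ∈ Finset.range H, ∑ h' ∈ Finset.range H,
        ∑ m ∈ I, v (m + h) * (starRingEnd ℂ) (v (m + h')) := by
      push_cast
      rw [Finset.sum_congr rfl fun m _ => (Complex.mul_conj' (F m)).symm]
      simp_rw [hF, map_sum, Finset.sum_mul_sum]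
      rw [Finset.sum_comm]
      exact Finset.sum_congr rfl fun h _ => Finset.sum_comm
    have e' : ∑ m ∈ I, ‖F m‖ ^ 2 = ‖((∑ m ∈ I, ‖F m‖ ^ 2 : ℝ) : ℂ)‖ := by
      rw [Complex.norm_real, Real.norm_of_nonneg (Finset.sum_nonneg fun _ _ => sq_nonneg _)]
    rw [e', e]
    refine (norm_sum_le _ _).trans (Finset.sum_le_sum fun h hh => (norm_sum_le _ _).trans
      (Finset.sum_le_sum fun h' hh' => ?_))
    exact (hcorr h (Finset.mem_range.1 hh) h' (Finset.mem_range.1 hh')).le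
  have hdouble : ∑ h ∈ Finset.range H, ∑ h' ∈ Finset.range H,
      ‖autocorrelation u N (Nat.dist h h')‖ ≤
        H * (2 * ∑ k ∈ Finset.range H, ‖autocorrelation u N k‖) := by
    refine (Finset.sum_le_sum fun h hh => sum_natDist_le
      (a := fun k => ‖autocorrelation u N k‖) (fun _ => norm_nonneg _)
      (Finset.mem_range.1 hh)).trans ?_
    simp
  have hCS : (H * ‖∑ n ∈ Finset.range N, u n‖) ^ 2 ≤ (N + H) * ∑ m ∈ I, ‖F m‖ ^ 2 := by
    have h1 : H * ‖∑ n ∈ Finset.range N, u n‖ = ‖∑ m ∈ I, F m‖ := by rw [hsum]; simp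
    rw [h1, ← hcard]
    refine le_trans ?_ (sq_sum_le_card_mul_sum_sq (s := I) (f := fun m => ‖F m‖))
    gcongr
    exact norm_sum_le _ _
  have hH' : (0 : ℝ) < H := by exact_mod_cast hH
  have hfin : (H * ‖∑ n ∈ Finset.range N, u n‖) ^ 2 ≤
      (N + H) * (H * (2 * ∑ k ∈ Finset.range H, ‖autocorrelation u N k‖)) :=
    hCS.trans (mul_le_mul_of_nonneg_left (hsq.trans hdouble) (by positivity))
  refine le_of_mul_le_mul_left ?_ hH'
  linarith

lemma norm_exp_two_pi_I_mul (s t : ℝ) : ‖Complex.exp (2 * Real.pi * Complex.I * s * t)‖ = 1 := by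
  have : (2 * Real.pi * Complex.I * s * t : ℂ) = ((2 * Real.pi * s * t : ℝ) : ℂ) * Complex.I := by
    push_cast; ring
  rw [this, Complex.norm_exp_ofReal_mul_I]

/-- In each product the phases leave only `e^{2πikt}`, independent of `n`. -/
lemma norm_autocorrelation_mul_exp (u : ℕ → ℂ) (t : ℝ) (N k : ℕ) :
    ‖autocorrelation (fun n => u n * Complex.exp (2 * Real.pi * Complex.I * n * t)) N k‖ =
      ‖autocorrelation u N k‖ := by
  have h : autocorrelation (fun n => u n * Complex.exp (2 * Real.pi * Complex.I * n * t)) N k =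
      Complex.exp (2 * Real.pi * Complex.I * (k : ℝ) * t) * autocorrelation u N k := by
    rw [autocorrelation, autocorrelation, Finset.mul_sum]
    refine Finset.sum_congr rfl fun n _ => ?_
    rw [map_mul, ← Complex.exp_conj]
    have hexp : Complex.exp (2 * Real.pi * Complex.I * (n + k : ℕ) * t) *
        Complex.exp ((starRingEnd ℂ) (2 * Real.pi * Complex.I * n * t)) =
          Complex.exp (2 * Real.pi * Complex.I * (k : ℝ) * t) := by
      rw [← Complex.exp_add]
      congr 1
      have h2 : (starRingEnd ℂ) (2 : ℂ) = 2 := Complex.conj_ofNat 2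
      simp only [map_mul, h2, Complex.conj_ofReal, Complex.conj_I, Complex.conj_natCast]
      push_cast
      ring
    linear_combination (u (n + k) * (starRingEnd ℂ) (u n)) * hexp
  rw [h, norm_mul, norm_exp_two_pi_I_mul, one_mul]

open Filter Topology in
/-- If the autocorrelations of `u` exist and tend to zero in the Cesàro sense, then the averages of
`u n * exp (2πint)` tend to zero uniformly in `t`. -/
theorem eventually_norm_sum_mul_exp_le {u c : ℕ → ℂ}
    (hc : ∀ k, Tendsto (fun N : ℕ => (∑ n ∈ Finset.range N,
      u (n + k) * (starRingEnd ℂ) (u n)) / N) atTop (𝓝 (c k)))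
    (hc0 : Tendsto (fun H : ℕ => (∑ k ∈ Finset.range H, ‖c k‖) / H) atTop (𝓝 0))
    {ε : ℝ} (hε : 0 < ε) :
    ∀ᶠ N : ℕ in atTop, ∀ t : ℝ,
      ‖∑ n ∈ Finset.range N, u n * Complex.exp (2 * Real.pi * Complex.I * n * t)‖ ≤ ε * N := by
  have hauto (k : ℕ) : Tendsto (fun N : ℕ => ‖autocorrelation u N k‖ / N) atTop (𝓝 ‖c k‖) := by
    -- At length `N + k` the truncated sum has exactly `N` terms; the normalisation changes by `N /
    -- (N + k) → 1`.
    rw [← tendsto_add_atTop_iff_nat k]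
    have h := ((hc k).mul (tendsto_natCast_div_add_atTop (𝕜 := ℂ) (k : ℂ))).norm
    rw [mul_one] at h
    refine h.congr' ?_
    filter_upwards [eventually_gt_atTop 0] with N hN
    have hN' : (N : ℂ) ≠ 0 := by exact_mod_cast hN.ne'
    rw [div_mul_div_cancel₀ hN', norm_div, autocorrelation, Nat.add_sub_cancel]
    congr 1
    exact_mod_cast Complex.norm_natCast (N + k)
  -- For `N ≥ H` the bound is `2 * (2 * N) * (2 * δ * H) * N = 8 * δ * H * N ^ 2`, which should be
  -- `H * (ε * N) ^ 2`.
  set δ := ε ^ 2 / 8 with hδ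
  have hδ0 : 0 < δ := by positivity
  obtain ⟨H, hH1, hH0⟩ := ((hc0.eventually_lt_const hδ0).and (eventually_gt_atTop 0)).exists
  have hH' : (0 : ℝ) < H := by exact_mod_cast hH0
  rw [div_lt_iff₀ hH'] at hH1
  have hsum : Tendsto (fun N : ℕ => ∑ k ∈ Finset.range H, ‖autocorrelation u N k‖ / N) atTop
      (𝓝 (∑ k ∈ Finset.range H, ‖c k‖)) := tendsto_finsetSum _ fun k _ => hauto k
  filter_upwards [hsum.eventually_lt_const (u := 2 * (δ * H)) (hH1.trans (by
    have := mul_pos hδ0 hH'; linarith)), eventually_ge_atTop H, eventually_gt_atTop 0]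
    with N hN hNH hN0 t
  have hN' : (0 : ℝ) < N := by exact_mod_cast hN0
  have hNH' : (H : ℝ) ≤ N := by exact_mod_cast hNH
  have hv := vanDerCorput_inequality
    (fun n => u n * Complex.exp (2 * Real.pi * Complex.I * n * t)) N hH0
  simp_rw [norm_autocorrelation_mul_exp] at hv
  rw [← Finset.sum_div, div_lt_iff₀ hN'] at hN
  have h1 : H * ‖∑ n ∈ Finset.range N, u n * Complex.exp (2 * Real.pi * Complex.I * n * t)‖ ^ 2 ≤
      H * (ε * N) ^ 2 := by
    refine hv.trans ?_
    calc _ ≤ 2 * (N + N) * (2 * (δ * H) * N) := by gcongr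
      _ = H * (ε * N) ^ 2 := by rw [hδ]; ring
  exact (pow_le_pow_iff_left₀ (norm_nonneg _) (by positivity) two_ne_zero).1
    (le_of_mul_le_mul_left h1 hH')

/-! ### Spectral measures and Wiener's lemma. -/

section SpectralMeasure

variable {E : Type*} [NormedAddCommGroup E] [InnerProductSpace ℂ E] [CompleteSpace E]

/-- A real-valued continuous function, as a complex-valued one. -/
def ContinuousMap.toComplex {K : Type*} [TopologicalSpace K] (g : C(K, ℝ)) : C(K, ℂ) :=
  ⟨fun x => (g x : ℂ), Complex.continuous_ofReal.comp g.continuous⟩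

lemma inner_cfcHom_mul_star_self {U : E →L[ℂ] E} (hU : IsStarNormal U) (f : E)
    (s : C(spectrum ℂ U, ℂ)) :
    inner ℂ f (cfcHom (R := ℂ) hU (star s * s) f) = (‖cfcHom (R := ℂ) hU s f‖ : ℂ) ^ 2 := by
  rw [map_mul, map_star, mul_apply_eq_comp, ContinuousLinearMap.star_eq_adjoint,
    ContinuousLinearMap.adjoint_inner_right, inner_self_eq_norm_sq_to_K]
  rfl

/-- With `s = √g` the value is the squared norm of `s(U) f`. This is the positivity needed for
Riesz–Markov–Kakutani. -/
lemma inner_cfcHom_toComplex_of_nonneg {U : E →L[ℂ] E} (hU : IsStarNormal U) (f : E)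
    {g : C(spectrum ℂ U, ℝ)} (hg : ∀ z, 0 ≤ g z) :
    0 ≤ (inner ℂ f (cfcHom (R := ℂ) hU g.toComplex f)).re := by
  set s : C(spectrum ℂ U, ℂ) :=
    ContinuousMap.toComplex ⟨fun z => Real.sqrt (g z), g.continuous.sqrt⟩ with hs
  have h : g.toComplex = star s * s := by
    ext z
    simp only [hs, ContinuousMap.toComplex, ContinuousMap.coe_mk, ContinuousMap.mul_apply,
      ContinuousMap.star_apply, RCLike.star_def, Complex.conj_ofReal, ← Complex.ofReal_mul,
      Real.mul_self_sqrt (hg z)]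
  rw [h, inner_cfcHom_mul_star_self]
  norm_cast
  positivity

lemma inner_cfcHom_toComplex_im {U : E →L[ℂ] E} (hU : IsStarNormal U) (f : E)
    (g : C(spectrum ℂ U, ℝ)) :
    (inner ℂ f (cfcHom (R := ℂ) hU g.toComplex f)).im = 0 := by
  have hsa : star g.toComplex = g.toComplex := by
    ext z
    simp [ContinuousMap.toComplex]
  have h : inner ℂ (cfcHom (R := ℂ) hU g.toComplex f) f =
      inner ℂ f (cfcHom (R := ℂ) hU g.toComplex f) := by
    nth_rw 2 [← hsa]
    rw [map_star, ContinuousLinearMap.star_eq_adjoint, ContinuousLinearMap.adjoint_inner_right]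
  have h2 := inner_conj_symm (𝕜 := ℂ) f (cfcHom (R := ℂ) hU g.toComplex f)
  rw [h] at h2
  exact Complex.conj_eq_iff_im.1 h2

/-- The spectral measure of a normal operator `U` at a vector `f`. -/
theorem exists_spectralMeasure {U : E →L[ℂ] E} (hU : IsStarNormal U) (f : E) :
    ∃ σ : Measure (spectrum ℂ U), IsFiniteMeasure σ ∧
      ∀ g : C(spectrum ℂ U, ℂ), ∫ z, g z ∂σ = inner ℂ f (cfcHom (R := ℂ) hU g f) := by
  let Λ₀ : CompactlySupportedContinuousMap (spectrum ℂ U) ℝ →ₗ[ℝ] ℝ :=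
    { toFun := fun g =>
        (inner ℂ f (cfcHom (R := ℂ) hU (ContinuousMap.toComplex g.toContinuousMap) f)).re
      map_add' := by
        intro g₁ g₂
        have : ContinuousMap.toComplex (g₁ + g₂).toContinuousMap =
            ContinuousMap.toComplex g₁.toContinuousMap +
              ContinuousMap.toComplex g₂.toContinuousMap := by
          ext z
          simp [ContinuousMap.toComplex]
        rw [this, map_add, add_apply, inner_add_right, Complex.add_re]
      map_smul' := by
        intro c g
        have : ContinuousMap.toComplex (c • g).toContinuousMap =
            (c : ℂ) • ContinuousMap.toComplex g.toContinuousMap := by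
          ext z
          simp [ContinuousMap.toComplex]
        rw [this, map_smul, smul_apply, inner_smul_right, Complex.re_ofReal_mul]
        rfl }
  let Λ : CompactlySupportedContinuousMap (spectrum ℂ U) ℝ →ₚ[ℝ] ℝ :=
    PositiveLinearMap.mk₀ Λ₀ fun g hg => inner_cfcHom_toComplex_of_nonneg hU f fun z => hg z
  have hΛ : ∀ g : C(spectrum ℂ U, ℝ), ((∫ z, g z ∂(RealRMK.rieszMeasure Λ) : ℝ) : ℂ) =
      inner ℂ f (cfcHom (R := ℂ) hU g.toComplex f) := by
    intro g
    have h1 := RealRMK.integral_rieszMeasure Λ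
      (CompactlySupportedContinuousMap.continuousMapEquiv g)
    have h2 : Λ (CompactlySupportedContinuousMap.continuousMapEquiv g) =
        (inner ℂ f (cfcHom (R := ℂ) hU g.toComplex f)).re := rfl
    rw [h2] at h1
    refine Complex.ext ?_ ?_
    · rw [Complex.ofReal_re]
      exact h1
    · rw [Complex.ofReal_im, inner_cfcHom_toComplex_im]
  have hfin : IsFiniteMeasure (RealRMK.rieszMeasure Λ) :=
    ⟨isCompact_univ.measure_lt_top⟩
  refine ⟨RealRMK.rieszMeasure Λ, hfin, fun g => ?_⟩
  have hgint : Integrable (fun z => g z) (RealRMK.rieszMeasure Λ) :=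
    g.continuous.integrable_of_hasCompactSupport (HasCompactSupport.of_compactSpace _)
  let gr : C(spectrum ℂ U, ℝ) := ⟨fun z => (g z).re, Complex.continuous_re.comp g.continuous⟩
  let gi : C(spectrum ℂ U, ℝ) := ⟨fun z => (g z).im, Complex.continuous_im.comp g.continuous⟩
  have hg : g = gr.toComplex + Complex.I • gi.toComplex := by
    ext z
    simp [gr, gi, ContinuousMap.toComplex, mul_comm Complex.I]
  have h3 := integral_re_add_im hgint
  rw [← h3]
  conv_rhs => rw [hg]
  rw [map_add, map_smul, add_apply, smul_apply,
    inner_add_right, inner_smul_right, ← hΛ gr, ← hΛ gi, mul_comm Complex.I]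
  rfl

lemma norm_le_one_of_mem_unitary {U : E →L[ℂ] E} (hU : U ∈ unitary (E →L[ℂ] E)) : ‖U‖ ≤ 1 := by
  refine U.opNorm_le_bound zero_le_one fun x => ?_
  rw [one_mul]
  have h := (ContinuousLinearMap.norm_map_iff_adjoint_comp_self U).2 (Unitary.mem_iff.1 hU).1 x
  exact h.le

open Filter Topology in
/-- If `f` is orthogonal to the `z`-eigenspace of the contraction `U`, `‖z‖ = 1`, then the averages
of `conj z ^ n • U ^ n f` tend to zero. -/
lemma tendsto_average_twisted_pow {U : E →L[ℂ] E} (hU : ‖U‖ ≤ 1) {z : ℂ} (hz : ‖z‖ = 1)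
    {f : E} (hf : ∀ v, U v = z • v → inner ℂ v f = 0) :
    Tendsto (fun N : ℕ => (N : ℂ)⁻¹ • ∑ n ∈ Finset.range N, (starRingEnd ℂ z) ^ n • (U ^ n) f)
      atTop (𝓝 0) := by
  have hzz : z * starRingEnd ℂ z = 1 := by rw [Complex.mul_conj', hz]; simp
  set V : E →L[ℂ] E := starRingEnd ℂ z • U with hV
  have hVn : ‖V‖ ≤ 1 := by
    rw [hV, norm_smul, RCLike.norm_conj, hz, one_mul]
    exact hU
  have h := V.tendsto_birkhoffAverage_orthogonalProjection hVn f
  -- Fixed vectors of `V = conj z • U` are `z`-eigenvectors of `U`, so the limit given by the mean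
  -- ergodic theorem is zero.
  have hp : (V.eqLocus (1 : E →L[ℂ] E)).orthogonalProjectionOnto f = 0 := by
    rw [Submodule.orthogonalProjectionOnto_eq_zero_iff, Submodule.mem_orthogonal]
    intro v hv
    refine hf v ?_
    have hv' : starRingEnd ℂ z • U v = v := hv
    nth_rw 2 [← hv']
    rw [smul_smul, hzz, one_smul]
  rw [hp] at h
  refine h.congr fun N => ?_
  rw [birkhoffAverage, birkhoffSum]
  congr 1
  refine Finset.sum_congr rfl fun n _ => ?_
  have hpow : V^[n] f = (V ^ n) f := by
    exact congr_fun (hom_coe_pow (fun W : E →L[ℂ] E => (W : E → E)) rfl (fun _ _ => rfl) V n).symm f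
  rw [id, hpow, hV, smul_pow]
  rfl

open Filter Topology in
/-- **Wiener's lemma** for unitary operators: if `f` is orthogonal to all eigenvectors of `U`, then
`|⟪f, U ^ n f⟫| ^ 2` tends to zero in the Cesàro sense. -/
theorem tendsto_average_norm_inner_pow_sq {U : E →L[ℂ] E} (hU : U ∈ unitary (E →L[ℂ] E)) {f : E}
    (hf : ∀ (c : ℂ) (v : E), U v = c • v → inner ℂ v f = 0) :
    Tendsto (fun N : ℕ => (∑ n ∈ Finset.range N, ‖inner ℂ f ((U ^ n) f)‖ ^ 2) / N)
      atTop (𝓝 0) := by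
  have hnormal : IsStarNormal U :=
    ⟨by rw [Commute, SemiconjBy, (Unitary.mem_iff.1 hU).1, (Unitary.mem_iff.1 hU).2]⟩
  have hU1 := norm_le_one_of_mem_unitary hU
  obtain ⟨σ, hσ, hInt⟩ := exists_spectralMeasure hnormal f
  set c : ℕ → ℂ := fun n => inner ℂ f ((U ^ n) f) with hc
  set ι : C(spectrum ℂ U, ℂ) := (ContinuousMap.id ℂ).restrict (spectrum ℂ U) with hι
  have hz : ∀ z : spectrum ℂ U, ‖(z : ℂ)‖ = 1 := fun z => by
    simpa using spectrum.subset_circle_of_unitary (𝕜 := ℂ) hU z.2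
  have hcn : ∀ n, ∫ z, (z : ℂ) ^ n ∂σ = c n := by
    intro n
    have h := hInt (ι ^ n)
    rw [map_pow, cfcHom_id] at h
    exact h
  have hcn' : ∀ n, ∫ z : spectrum ℂ U, (starRingEnd ℂ (z : ℂ)) ^ n ∂σ = starRingEnd ℂ (c n) := by
    intro n
    rw [← hcn, ← integral_conj]
    simp_rw [map_pow]
  have hcle : ∀ n, ‖c n‖ ≤ ‖f‖ ^ 2 := by
    intro n
    refine (norm_inner_le_norm _ _).trans ?_
    rw [sq]
    refine mul_le_mul_of_nonneg_left ?_ (norm_nonneg f)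
    refine ((U ^ n).le_opNorm f).trans ?_
    have h1 : ‖U ^ n‖ ≤ 1 := norm_le_one_of_mem_unitary (pow_mem hU n)
    exact mul_le_of_le_one_left (norm_nonneg f) h1
  have hcont : ∀ n, Continuous fun z : spectrum ℂ U => (starRingEnd ℂ (z : ℂ)) ^ n := fun n =>
    (Complex.continuous_conj.comp continuous_subtype_val).pow n
  have hcint : ∀ n, Integrable (fun z : spectrum ℂ U => (starRingEnd ℂ (z : ℂ)) ^ n) σ := fun n =>
    (hcont n).integrable_of_hasCompactSupport (HasCompactSupport.of_compactSpace _)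
  -- Writing one factor of `‖c n‖ ^ 2` as `∫ conj z ^ n ∂σ` turns the Cesàro mean into `∫ F N ∂σ`.
  -- For each `z`, `F N z` is the inner product of `f` with a twisted ergodic average, hence tends
  -- to zero; it is bounded by `‖f‖ ^ 2`.
  set F : ℕ → spectrum ℂ U → ℂ := fun N z =>
    (N : ℂ)⁻¹ * ∑ n ∈ Finset.range N, c n * (starRingEnd ℂ (z : ℂ)) ^ n with hF
  have hFint : ∀ N, ∫ z, F N z ∂σ =
      (((∑ n ∈ Finset.range N, ‖c n‖ ^ 2) / N : ℝ) : ℂ) := by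
    intro N
    rw [hF, integral_const_mul, integral_finsetSum _ fun n _ => (hcint n).const_mul (c n)]
    simp_rw [integral_const_mul, hcn', Complex.mul_conj']
    push_cast
    rw [div_eq_inv_mul]
  have hlim : Tendsto (fun N => ∫ z, F N z ∂σ) atTop (𝓝 (∫ _, (0 : ℂ) ∂σ)) := by
    refine tendsto_integral_of_dominated_convergence (fun _ => ‖f‖ ^ 2) ?_ ?_ ?_ ?_
    · intro N
      refine Continuous.aestronglyMeasurable ?_
      exact continuous_const.mul (continuous_finsetSum _ fun n _ => continuous_const.mul (hcont n))
    · exact integrable_const _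
    · intro N
      refine Eventually.of_forall fun z => ?_
      rw [hF, norm_mul, norm_inv, Complex.norm_natCast]
      have h1 : ‖∑ n ∈ Finset.range N, c n * (starRingEnd ℂ (z : ℂ)) ^ n‖ ≤ N * ‖f‖ ^ 2 := by
        refine (norm_sum_le _ _).trans ?_
        refine (Finset.sum_le_sum (g := fun _ => ‖f‖ ^ 2) fun n _ => ?_).trans ?_
        · rw [norm_mul, norm_pow, RCLike.norm_conj, hz, one_pow, mul_one]
          exact hcle n
        · simp
      rcases Nat.eq_zero_or_pos N with rfl | hN
      · simp
      · have hN' : (0 : ℝ) < N := by exact_mod_cast hN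
        rw [inv_mul_le_iff₀ hN']
        exact h1
    · refine Eventually.of_forall fun z => ?_
      have h := tendsto_average_twisted_pow hU1 (hz z) (f := f) (hf z)
      have h' := (tendsto_const_nhds (x := f)).inner (𝕜 := ℂ) h
      rw [inner_zero_right] at h'
      refine h'.congr fun N => ?_
      rw [inner_smul_right, inner_sum]
      simp_rw [inner_smul_right]
      rw [hF]
      simp_rw [hc, mul_comm]
  simp_rw [hFint, integral_zero] at hlim
  have := (Complex.continuous_re.tendsto _).comp hlim
  simpa only [Function.comp_def, Complex.ofReal_re, Complex.zero_re] using this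

open Filter Topology in
lemma tendsto_average_of_tendsto_average_sq {a : ℕ → ℝ} (ha : ∀ n, 0 ≤ a n)
    (h : Tendsto (fun N : ℕ => (∑ n ∈ Finset.range N, a n ^ 2) / N) atTop (𝓝 0)) :
    Tendsto (fun N : ℕ => (∑ n ∈ Finset.range N, a n) / N) atTop (𝓝 0) := by
  have h' := (Real.continuous_sqrt.tendsto _).comp h
  rw [Real.sqrt_zero] at h'
  refine squeeze_zero (fun N => div_nonneg (Finset.sum_nonneg fun n _ => ha n) N.cast_nonneg)
    (fun N => ?_) h'
  refine Real.le_sqrt_of_sq_le ?_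
  rcases Nat.eq_zero_or_pos N with rfl | hN
  · simp
  have hN' : (0 : ℝ) < N := by exact_mod_cast hN
  have hcs := sq_sum_le_card_mul_sum_sq (s := Finset.range N) (f := a)
  rw [Finset.card_range] at hcs
  rw [div_pow, div_le_div_iff₀ (by positivity) hN']
  nlinarith

end SpectralMeasure

/-! ### Passage to arithmetic progressions. -/

lemma sum_exp_eq_ite_dvd {a : ℕ} (ha : 0 < a) (m : ℕ) :
    ∑ j ∈ Finset.range a, Complex.exp (2 * Real.pi * Complex.I * m * (j / a : ℝ)) =
      if a ∣ m then (a : ℂ) else 0 := by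
  have ha' : (a : ℂ) ≠ 0 := by exact_mod_cast ha.ne'
  set ζ := Complex.exp (2 * Real.pi * Complex.I * m / a) with hζ
  have hpow : ∀ j ∈ Finset.range a,
      Complex.exp (2 * Real.pi * Complex.I * m * (j / a : ℝ)) = ζ ^ j := by
    intro j _
    rw [hζ, ← Complex.exp_nat_mul]
    congr 1
    push_cast
    ring
  rw [Finset.sum_congr rfl hpow]
  have h2pi : (2 * Real.pi * Complex.I : ℂ) ≠ 0 := Complex.two_pi_I_ne_zero
  split_ifs with hd
  · obtain ⟨b, rfl⟩ := hd
    have h1 : ζ = 1 := by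
      rw [hζ, Complex.exp_eq_one_iff]
      refine ⟨b, ?_⟩
      push_cast
      field_simp
    simp [h1]
  · have h1 : ζ ≠ 1 := by
      intro h
      rw [hζ, Complex.exp_eq_one_iff] at h
      obtain ⟨b, hb⟩ := h
      rw [div_eq_iff ha'] at hb
      have hb' : (m : ℂ) = b * a := by
        apply mul_left_cancel₀ h2pi
        linear_combination hb
      have hb'' : (m : ℤ) = b * a := by exact_mod_cast hb'
      exact hd (Int.natCast_dvd_natCast.1 ⟨b, by rw [hb'', mul_comm]⟩)
    have hza : ζ ^ a = 1 := by
      rw [hζ, ← Complex.exp_nat_mul, Complex.exp_eq_one_iff]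
      refine ⟨m, ?_⟩
      push_cast
      field_simp
    rw [geom_sum_eq h1, hza, sub_self, zero_div]

lemma sum_mul_exp_progression {a : ℕ} (ha : 0 < a) (u : ℕ → ℂ) (N : ℕ) (t : ℝ) :
    a * ∑ n ∈ Finset.Icc 1 N, u (a * n) * Complex.exp (2 * Real.pi * Complex.I * n * t) =
      ∑ j ∈ Finset.range a, ∑ m ∈ Finset.Icc 1 (a * N),
        u m * Complex.exp (2 * Real.pi * Complex.I * m * ((t + j) / a : ℝ)) := by
  have ha' : (a : ℂ) ≠ 0 := by exact_mod_cast ha.ne'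
  rw [Finset.sum_comm]
  have h1 : ∀ m ∈ Finset.Icc 1 (a * N), ∑ j ∈ Finset.range a,
      u m * Complex.exp (2 * Real.pi * Complex.I * m * ((t + j) / a : ℝ)) =
        if a ∣ m then a * (u m * Complex.exp (2 * Real.pi * Complex.I * m * (t / a : ℝ)))
          else 0 := by
    intro m _
    have h2 : ∀ j ∈ Finset.range a,
        u m * Complex.exp (2 * Real.pi * Complex.I * m * ((t + j) / a : ℝ)) =
          u m * Complex.exp (2 * Real.pi * Complex.I * m * (t / a : ℝ)) *
            Complex.exp (2 * Real.pi * Complex.I * m * (j / a : ℝ)) := by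
      intro j _
      rw [mul_assoc (u m), ← Complex.exp_add]
      congr 2
      push_cast
      ring
    rw [Finset.sum_congr rfl h2, ← Finset.mul_sum, sum_exp_eq_ite_dvd ha]
    split_ifs
    · ring
    · simp
  rw [Finset.sum_congr rfl h1, ← Finset.sum_filter, Finset.mul_sum]
  refine Finset.sum_bij (fun n _ => a * n) ?_ ?_ ?_ ?_
  · intro n hn
    rw [Finset.mem_Icc] at hn
    rw [Finset.mem_filter, Finset.mem_Icc]
    exact ⟨⟨Nat.mul_pos ha hn.1, Nat.mul_le_mul_left a hn.2⟩, dvd_mul_right a n⟩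
  · intro n _ n' _ h
    exact Nat.eq_of_mul_eq_mul_left ha h
  · intro m hm
    rw [Finset.mem_filter, Finset.mem_Icc] at hm
    obtain ⟨⟨h1, h2⟩, b, rfl⟩ := hm
    refine ⟨b, ?_, rfl⟩
    rw [Finset.mem_Icc]
    exact ⟨Nat.pos_of_mul_pos_left h1, Nat.le_of_mul_le_mul_left h2 ha⟩
  · intro n _
    congr 3
    push_cast
    field_simp

open Filter in
lemma eventually_norm_sum_progression_le {u : ℕ → ℂ}
    (hu : ∀ ε : ℝ, 0 < ε → ∀ᶠ N : ℕ in atTop, ∀ t : ℝ,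
      ‖∑ n ∈ Finset.Icc 1 N, u n * Complex.exp (2 * Real.pi * Complex.I * n * t)‖ ≤ ε * N)
    {a : ℕ} (ha : 0 < a) {ε : ℝ} (hε : 0 < ε) :
    ∀ᶠ N : ℕ in atTop, ∀ t : ℝ,
      ‖∑ n ∈ Finset.Icc 1 N, u (a * n) * Complex.exp (2 * Real.pi * Complex.I * n * t)‖ ≤
        ε * N := by
  have ha' : (0 : ℝ) < a := by exact_mod_cast ha
  have htend : Tendsto (fun N : ℕ => a * N) atTop atTop :=
    tendsto_id.const_mul_atTop' ha
  -- Each of the `a` sums has length `a * N`, hence is at most `ε * N`; the factor `a` on the left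
  -- cancels their number.
  filter_upwards [htend.eventually (hu (ε / a) (by positivity))] with N hN t
  refine le_of_mul_le_mul_left ?_ ha'
  have h := sum_mul_exp_progression ha u N t
  rw [← Complex.norm_natCast, ← norm_mul, h]
  refine (norm_sum_le _ _).trans ((Finset.sum_le_sum fun j _ => hN _).trans ?_)
  rw [Finset.sum_const, Finset.card_range, nsmul_eq_mul, Complex.norm_natCast]
  push_cast
  field_simp
  exact le_rfl

/-! ### Orbits, the Koopman operator and the conclusion. -/

lemma norm_sum_Icc_mul_exp (u : ℕ → ℂ) (N : ℕ) (t : ℝ) :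
    ‖∑ n ∈ Finset.Icc 1 N, u n * Complex.exp (2 * Real.pi * Complex.I * n * t)‖ =
      ‖∑ n ∈ Finset.range N, u (n + 1) * Complex.exp (2 * Real.pi * Complex.I * n * t)‖ := by
  have h : ∑ n ∈ Finset.Icc 1 N, u n * Complex.exp (2 * Real.pi * Complex.I * n * t) =
      Complex.exp (2 * Real.pi * Complex.I * (1 : ℝ) * t) *
        ∑ n ∈ Finset.range N, u (n + 1) * Complex.exp (2 * Real.pi * Complex.I * n * t) := by
    rw [Finset.range_eq_Ico, Finset.mul_sum, ← Finset.Ico_succ_right_eq_Icc]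
    rw [Finset.sum_Ico_eq_sum_range, Finset.sum_Ico_eq_sum_range]
    refine Finset.sum_congr rfl fun n _ => ?_
    rw [mul_left_comm, ← Complex.exp_add]
    congr 2
    · ring_nf
    · push_cast
      ring
  rw [h, norm_mul, norm_exp_two_pi_I_mul, one_mul]

lemma LinearIsometry.mem_unitary_of_surjective {E : Type*} [NormedAddCommGroup E]
    [InnerProductSpace ℂ E] [CompleteSpace E] (V : E →ₗᵢ[ℂ] E) (hV : Function.Surjective V) :
    V.toContinuousLinearMap ∈ unitary (E →L[ℂ] E) :=
  (Unitary.linearIsometryEquiv.symm (LinearIsometryEquiv.ofSurjective V hV)).2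

section WienerWintner

variable {X : Type*} [MeasurableSpace X] {μ : Measure X}

open Filter Topology in
/-- If the correlations of `f` along the ergodic map `S` tend to zero in the Cesàro sense, then
almost every orbit satisfies the uniform Wiener–Wintner property. -/
theorem ae_eventually_norm_sum_orbit_le [IsProbabilityMeasure μ] {S : X → X} (hS : Ergodic S μ)
    {f : X → ℂ} (hf : MemLp f 2 μ)
    (hcorr : Tendsto (fun H : ℕ => (∑ k ∈ Finset.range H,
      ‖∫ x, f (S^[k] x) * (starRingEnd ℂ) (f x) ∂μ‖) / H) atTop (𝓝 0)) :
    ∀ᵐ x ∂μ, ∀ ε : ℝ, 0 < ε → ∀ᶠ N : ℕ in atTop, ∀ t : ℝ,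
      ‖∑ n ∈ Finset.Icc 1 N, f (S^[n] x) * Complex.exp (2 * Real.pi * Complex.I * n * t)‖ ≤
        ε * N := by
  have hmp := hS.toMeasurePreserving
  have hInt (k : ℕ) : Integrable (fun x => f (S^[k] x) * (starRingEnd ℂ) (f x)) μ :=
    (hf.comp_measurePreserving (hmp.iterate k)).integrable_mul hf.star
  have hB : ∀ᵐ x ∂μ, ∀ k : ℕ, Tendsto (fun n : ℕ =>
      birkhoffSum S (fun x => f (S^[k] x) * (starRingEnd ℂ) (f x)) n x / n) atTop
        (𝓝 (∫ x, f (S^[k] x) * (starRingEnd ℂ) (f x) ∂μ)) :=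
    ae_all_iff.2 fun k => ae_tendsto_birkhoffSum_div_complex hS (hInt k)
  -- The sums start at `n = 1`, so the ergodic theorem is used at `S x`.
  filter_upwards [hmp.quasiMeasurePreserving.ae hB] with x hx ε hε
  have h := eventually_norm_sum_mul_exp_le (u := fun n => f (S^[n + 1] x))
    (c := fun k => ∫ x, f (S^[k] x) * (starRingEnd ℂ) (f x) ∂μ) (fun k => ?_) hcorr hε
  · filter_upwards [h] with N hN t
    rw [norm_sum_Icc_mul_exp (fun n => f (S^[n] x))]
    exact hN t
  · refine (hx k).congr fun N => ?_
    congr 1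
    refine Finset.sum_congr rfl fun n _ => ?_
    have h1 : S^[n + k + 1] x = S^[k] (S^[n] (S x)) := by
      rw [Function.iterate_succ_apply, add_comm n k, Function.iterate_add_apply]
    simp only [h1, Function.iterate_succ_apply]

lemma koopman_pow_toLp {T : X → X} (hT : MeasurePreserving T μ μ) {f : X → ℂ} (hf : MemLp f 2 μ)
    (n : ℕ) :
    (((Lp.compMeasurePreservingₗᵢ ℂ T hT).toContinuousLinearMap : Lp ℂ 2 μ →L[ℂ] Lp ℂ 2 μ) ^ n)
      (hf.toLp f) = (hf.comp_measurePreserving (hT.iterate n)).toLp (f ∘ T^[n]) := by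
  induction n with
  | zero => rfl
  | succ n ih =>
    rw [pow_succ', mul_apply_eq_comp, ih]
    rfl

lemma inner_koopman_pow_toLp {T : X → X} (hT : MeasurePreserving T μ μ) {f : X → ℂ}
    (hf : MemLp f 2 μ) (n : ℕ) :
    inner ℂ (hf.toLp f) ((((Lp.compMeasurePreservingₗᵢ ℂ T hT).toContinuousLinearMap :
      Lp ℂ 2 μ →L[ℂ] Lp ℂ 2 μ) ^ n) (hf.toLp f)) =
        ∫ x, f (T^[n] x) * (starRingEnd ℂ) (f x) ∂μ := by
  rw [koopman_pow_toLp, L2.inner_def]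
  refine integral_congr_ae ?_
  filter_upwards [hf.coeFn_toLp, (hf.comp_measurePreserving (hT.iterate n)).coeFn_toLp]
    with x h1 h2
  rw [h1, h2, RCLike.inner_apply]
  rfl

lemma koopman_mem_unitary (T : X ≃ᵐ X) (hT : MeasurePreserving T μ μ) :
    ((Lp.compMeasurePreservingₗᵢ ℂ T hT).toContinuousLinearMap : Lp ℂ 2 μ →L[ℂ] Lp ℂ 2 μ) ∈
      unitary (Lp ℂ 2 μ →L[ℂ] Lp ℂ 2 μ) := by
  have hsymm : MeasurePreserving T.symm μ μ := hT.symm T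
  -- The Koopman operator is always isometric; invertibility of `T` makes it unitary.
  have hsurj : Function.Surjective (Lp.compMeasurePreservingₗᵢ (p := 2) ℂ (E := ℂ) T hT) := by
    intro g
    refine ⟨Lp.compMeasurePreserving T.symm hsymm g, ?_⟩
    change Lp.compMeasurePreserving T hT (Lp.compMeasurePreserving T.symm hsymm g) = g
    rw [← Lp.compMeasurePreserving_comp_apply]
    have : (T.symm ∘ T : X → X) = id := by ext x; simp
    simp [this]
  exact LinearIsometry.mem_unitary_of_surjective _ hsurj

open Filter Topology in
/-- The correlations of a function orthogonal to the Kronecker factor tend to zero in the Cesàro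
sense. -/
theorem tendsto_average_norm_correlation (T : X ≃ᵐ X) (hT : MeasurePreserving T μ μ) {f : X → ℂ}
    (hf : MemLp f 2 μ) (hfZ : hf.toLp f ∈ (kroneckerFactor T hT)ᗮ) :
    Tendsto (fun H : ℕ => (∑ k ∈ Finset.range H,
      ‖∫ x, f (T^[k] x) * (starRingEnd ℂ) (f x) ∂μ‖) / H) atTop (𝓝 0) := by
  refine tendsto_average_of_tendsto_average_sq (fun _ => norm_nonneg _) ?_
  simp_rw [← inner_koopman_pow_toLp hT hf]
  refine tendsto_average_norm_inner_pow_sq (koopman_mem_unitary T hT) fun c v hv => ?_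
  refine (Submodule.mem_orthogonal _ _).1 hfZ v (Submodule.le_topologicalClosure _ ?_)
  exact Submodule.mem_iSup_of_mem c (Module.End.mem_eigenspace_iff.2 hv)

/-- Change of variables by `T^k`. Correlations along `T⁻¹` thus have the same moduli, so the decay
for `T` also serves negative `a`. -/
lemma integral_correlation_symm (T : X ≃ᵐ X) (hT : MeasurePreserving T μ μ) (f : X → ℂ) (k : ℕ) :
    ∫ x, f (T.symm^[k] x) * (starRingEnd ℂ) (f x) ∂μ =
      (starRingEnd ℂ) (∫ x, f (T^[k] x) * (starRingEnd ℂ) (f x) ∂μ) := by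
  have hinv : Function.LeftInverse T.symm^[k] T^[k] :=
    Function.LeftInverse.iterate T.symm_apply_apply k
  have hemb : MeasurableEmbedding T^[k] := by
    clear hinv
    induction k with
    | zero => exact MeasurableEmbedding.id
    | succ k ih => exact ih.comp T.measurableEmbedding
  rw [← (hT.iterate k).integral_comp hemb, ← integral_conj]
  refine integral_congr_ae (Filter.Eventually.of_forall fun x => ?_)
  simp only [hinv x, map_mul, Complex.conj_conj]
  ring

open Filter Topology in
lemma limsup_iSup_enorm_wienerWintnerAvg_eq_zero {T : X ≃ᵐ X} {f : X → ℂ} {a : ℤ} {x : X}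
    (h : ∀ ε : ℝ, 0 < ε → ∀ᶠ N : ℕ in atTop, ∀ t : ℝ,
      ‖∑ n ∈ Finset.Icc 1 N, f (((T.toEquiv : Equiv.Perm X) ^ (a * (n : ℤ))) x) *
        Complex.exp (2 * Real.pi * Complex.I * n * t)‖ ≤ ε * N) :
    limsup (fun N : ℕ => ⨆ t : ℝ, ‖wienerWintnerAvg T f a x N t‖ₑ) atTop = 0 := by
  refine Tendsto.limsup_eq ?_
  rw [ENNReal.tendsto_nhds_zero]
  intro ε hε
  obtain ⟨δ, hδ0, hδ⟩ : ∃ δ : ℝ, 0 < δ ∧ ENNReal.ofReal δ ≤ ε := by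
    obtain ⟨r, hr0, hr⟩ := ENNReal.lt_iff_exists_nnreal_btwn.1 hε
    exact ⟨r, by exact_mod_cast hr0, by simpa using hr.le⟩
  filter_upwards [h δ hδ0, eventually_gt_atTop 0] with N hN hpos
  refine iSup_le fun t => le_trans ?_ hδ
  have hN' : (0 : ℝ) < N := by exact_mod_cast hpos
  rw [← ofReal_norm]
  refine ENNReal.ofReal_le_ofReal ?_
  rw [wienerWintnerAvg, norm_mul, norm_div, norm_one, Complex.norm_natCast, one_div,
    inv_mul_le_iff₀ hN', mul_comm (N : ℝ)]
  exact hN t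

end WienerWintner

theorem mainTheorem2 {X : Type*} [MeasurableSpace X] (μ : MeasureTheory.Measure X)
    [MeasureTheory.IsProbabilityMeasure μ] (T : X ≃ᵐ X) (hT : Ergodic T μ)
    (f : X → ℂ) (hf : MeasureTheory.MemLp f 2 μ)
    (hfZ : hf.toLp f ∈ (kroneckerFactor T hT.toMeasurePreserving)ᗮ) :
    ∃ Xf : Set X, MeasurableSet Xf ∧ μ Xfᶜ = 0 ∧
      ∀ x ∈ Xf, ∀ a : ℤ, a ≠ 0 →
        Filter.limsup (fun N : ℕ => ⨆ t : ℝ, ‖wienerWintnerAvg T f a x N t‖ₑ) Filter.atTop = 0 := by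
  have hcorr := tendsto_average_norm_correlation T hT.toMeasurePreserving hf hfZ
  have hcorr' := hcorr
  simp_rw [← Complex.norm_conj (∫ x, _ ∂μ),
    ← integral_correlation_symm T hT.toMeasurePreserving f] at hcorr'
  have hae := (ae_eventually_norm_sum_orbit_le hT hf hcorr).and
    (ae_eventually_norm_sum_orbit_le hT.symm hf hcorr')
  -- The good set itself need not be measurable, so its null complement is enlarged to a measurable
  -- null set. The choice does not depend on `a`.
  obtain ⟨s, hs, hsm, hs0⟩ := exists_measurable_superset_of_null (ae_iff.1 hae)
  refine ⟨sᶜ, hsm.compl, by rwa [compl_compl], fun x hx a ha => ?_⟩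
  have hx' := not_not.1 fun h => hx (hs h)
  refine limsup_iSup_enorm_wienerWintnerAvg_eq_zero fun ε hε => ?_
  obtain ⟨b, rfl | rfl⟩ := a.eq_nat_or_neg
  · have hb : 0 < b := by omega
    filter_upwards [eventually_norm_sum_progression_le hx'.1 hb hε] with N hN t
    refine le_of_eq_of_le ?_ (hN t)
    congr 1
  · have hb : 0 < b := by omega
    filter_upwards [eventually_norm_sum_progression_le hx'.2 hb hε] with N hN t
    refine le_of_eq_of_le ?_ (hN t)
    congr 1
    refine Finset.sum_congr rfl fun n _ => ?_
    rw [neg_mul, ← Nat.cast_mul, zpow_neg, zpow_natCast, ← inv_pow, ← Equiv.Perm.iterate_eq_pow]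
    rfl
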